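/- Let $a\in\mathbb{R}$, $\lambda\ge 0$, $\beta\in(0,1)$ and $p_{01},p_{11}\in(0,1]$ with $p_{11}\ge p_{01}$ and $a^2(1-p_{01})<1$. Put $\mathcal{T}(b):=b\,p_{11}+(1-b)\,p_{01}$ and, for $m\in\mathbb{R}$, let $F_m$ be the law of $|m+w|$ with $w\sim\mathcal{N}(0,1)$, i.e. the law on $\mathbb{R}_+=[0,\infty)$ with density $x\mapsto \frac{1}{\sqrt{2\pi}}\bigl(e^{-(x-m)^2/2}+e^{-(x+m)^2/2}\bigr)$. Consider the folded POMDP, i.e. the controlled Markov process with states $(\tilde e,\tilde b)\in\mathbb{R}_+\times[0,1]$ (error and belief), actions $\tilde u\in\{0,1\}$ ($1$ means transmit), one-stage cost $\tilde e^2+\lambda \tilde u$, and next-state law $\tilde p(\cdot\mid\tilde e,\tilde b;\tilde u)$ given by $$\tilde p(\cdot\mid\tilde e,\tilde b;0)=F_{a\tilde e}\otimes\delta_{\mathcal{T}(\tilde b)},\qquad \tilde p(\cdot\mid\tilde e,\tilde b;1)=\tilde b\,\bigl(F_0\otimes\delta_{p_{11}}\bigr)+(1-\tilde b)\,\bigl(F_{a\tilde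 e}\otimes\delta_{p_{01}}\bigr).$$ A policy $\phi$ chooses, at each time $t=0,1,2,\dots$, the action $\tilde u(t)$ as a measurable function of the states at times $0,\dots,t$. Let $\tilde V^\beta(\tilde e,\tilde b;\phi)=\mathbb{E}_\phi\sum_{t\ge0}\beta^t(\tilde e(t)^2+\lambda \tilde u(t))$ be its expected discounted cost from the initial state $(\tilde e,\tilde b)$, and $\tilde V^\beta(\tilde e,\tilde b)=\inf_\phi\tilde V^\beta(\tilde e,\tilde b;\phi)$ the optimal value function. Call an action $\tilde u$ optimal in state $(\tilde e,\tilde b)$ if it minimizes $$\tilde Q^\beta(\tilde e,\tilde b;\tilde u)=\tilde e^2+\lambda \tilde u+\beta\int\tilde V^\beta\,d\tilde p(\cdot\mid\tilde e,\tilde b;\tilde u)$$ over $\tilde u\in\{0,1\}$ and the minimum equals $\tilde V^\beta(\tilde e,\tilde b)$. Then $\tilde V^\beta$ is finite everywhere, and: (A) For each $\tilde b\in[0,1]$, $\tilde V^\beta(\cdot,\tilde b)$ is non-decreasing on $\mathbb{R}_+$. (B) For each $\tilde e\in\mathbb{R}_+$, $\tilde V^\beta(\tilde e,\cdot)$ is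 non-increasing on $[0,1]$. (C) For all $\tilde e\in\mathbb{R}_+$ and $x,y,\tilde b\in[0,1]$ with $x\ge y$, and $z=\tilde b x+(1-\tilde b)y$, $$(1-\tilde b)\lambda+\tilde b\,\tilde V^\beta(\tilde e,x)+(1-\tilde b)\,\tilde V^\beta(\tilde e,y)\ \ge\ \tilde V^\beta(\tilde e,z).$$ (D) For each $\tilde e\in\mathbb{R}_+$ there is a threshold $\tilde b^\star(\tilde e)\in\mathbb{R}$ (larger than $1$ if transmitting is never optimal) such that, for every $\tilde b\in[0,1]$, transmitting is optimal in state $(\tilde e,\tilde b)$ if and only if $\tilde b\ge\tilde b^\star(\tilde e)$. Moreover the stationary threshold policy that transmits exactly when $\tilde b\ge\tilde b^\star(\tilde e)$ is optimal, i.e. it attains $\tilde V^\beta$ from every initial state. -/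

import Mathlib

open MeasureTheory ProbabilityTheory
open scoped NNReal ENNReal unitInterval

noncomputable section

namespace RemoteEst

/-- A state `(e, b)` of the folded POMDP: a nonnegative error and a belief. -/
abbrev State : Type := ℝ≥0 × I

/-- The one-step belief update `b ↦ b p₁₁ + (1 - b) p₀₁` when nothing is transmitted. -/
def beliefStep (p01 p11 b : I) : I :=
  ⟨(b : ℝ) * p11 + (1 - (b : ℝ)) * p01, by
    refine ⟨?_, ?_⟩
    · have := mul_nonneg b.2.1 p11.2.1
      have := mul_nonneg (sub_nonneg.2 b.2.2) p01.2.1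
      linarith
    · have := mul_le_mul_of_nonneg_left p11.2.2 b.2.1
      have := mul_le_mul_of_nonneg_left p01.2.2 (sub_nonneg.2 b.2.2)
      linarith⟩

/-- The law on `ℝ≥0` with Lebesgue density `x ↦ f x + f (-x)`, where `f` is the density of the
normal distribution with mean `m` and unit variance: the folded law of the next error. -/
def foldedLaw (m : ℝ) : Measure ℝ≥0 :=
  ((volume.restrict (Set.Ici (0 : ℝ))).withDensity
    (fun x => gaussianPDF m 1 x + gaussianPDF m 1 (-x))).map Real.toNNReal

/-- The law of the next state of the folded POMDP, from state `s` and under action `u`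
(`true`: transmit, `u = 1`; `false`: do not transmit, `u = 0`). -/
def stepLaw (a : ℝ) (p01 p11 : I) (s : State) (u : Bool) : Measure State :=
  if u then
    ENNReal.ofReal (s.2 : ℝ) • (foldedLaw 0).prod (Measure.dirac p11) +
      ENNReal.ofReal (1 - (s.2 : ℝ)) • (foldedLaw (a * (s.1 : ℝ))).prod (Measure.dirac p01)
  else
    (foldedLaw (a * (s.1 : ℝ))).prod (Measure.dirac (beliefStep p01 p11 s.2))

/-- The one-stage cost `e² + lam u`. -/
def stageCost (lam : ℝ) (s : State) (u : Bool) : ℝ :=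
  (s.1 : ℝ) ^ 2 + lam * (if u then 1 else 0)

theorem foldedLaw_apply (m : ℝ) {B : Set ℝ≥0} (hB : MeasurableSet B) :
    foldedLaw m B = ∫⁻ x in Set.Ici (0 : ℝ) ∩ Real.toNNReal ⁻¹' B,
      (gaussianPDF m 1 x + gaussianPDF m 1 (-x)) := by
  have h : MeasurableSet (Real.toNNReal ⁻¹' B) := measurable_real_toNNReal hB
  rw [foldedLaw, Measure.map_apply measurable_real_toNNReal hB, withDensity_apply _ h,
    Measure.restrict_restrict h, Set.inter_comm]

instance foldedLaw_isProbabilityMeasure (m : ℝ) : IsProbabilityMeasure (foldedLaw m) := by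
  refine ⟨?_⟩
  rw [foldedLaw_apply m MeasurableSet.univ, Set.preimage_univ, Set.inter_univ,
    lintegral_add_left (measurable_gaussianPDF m 1)]
  have h : ∫⁻ x in Set.Ici (0 : ℝ), gaussianPDF m 1 (-x)
      = ∫⁻ x in Set.Iic (0 : ℝ), gaussianPDF m 1 x := by
    have := (Measure.measurePreserving_neg (volume : Measure ℝ)).setLIntegral_comp_preimage
      (s := Set.Iic (0 : ℝ)) measurableSet_Iic (measurable_gaussianPDF m 1)
    simpa using this
  rw [h, setLIntegral_congr (Iio_ae_eq_Iic (a := (0 : ℝ)) (μ := volume)).symm, ← Set.compl_Ici,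
    lintegral_add_compl _ measurableSet_Ici]
  exact lintegral_gaussianPDF_eq_one m one_ne_zero

theorem measurable_foldedLaw : Measurable foldedLaw := by
  refine Measure.measurable_of_measurable_coe _ fun B hB => ?_
  simp_rw [foldedLaw_apply _ hB]
  refine Measurable.lintegral_prod_right' (f := fun q : ℝ × ℝ =>
    gaussianPDF q.1 1 q.2 + gaussianPDF q.1 1 (-q.2)) ?_
  have h1 : Measurable fun q : ℝ × ℝ => gaussianPDF q.1 1 q.2 :=
    measurable_uncurry_gaussianPDF.comp
      (g := fun r : ℝ × ℝ≥0 × ℝ => gaussianPDF r.1 r.2.1 r.2.2)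
      (f := fun q : ℝ × ℝ => (q.1, (1 : ℝ≥0), q.2)) (by fun_prop)
  exact h1.add (h1.comp (f := fun q : ℝ × ℝ => (q.1, -q.2)) (by fun_prop))

theorem measurable_beliefStep (p01 p11 : I) : Measurable (beliefStep p01 p11) := by
  unfold beliefStep
  exact Measurable.subtype_mk (by fun_prop)

/-- The folded error law as a kernel. -/
def foldedKernel : Kernel ℝ ℝ≥0 := ⟨foldedLaw, measurable_foldedLaw⟩

instance : IsMarkovKernel foldedKernel := ⟨fun m => foldedLaw_isProbabilityMeasure m⟩

theorem measurable_foldedLaw_prod {α : Type*} [MeasurableSpace α] {f : α → ℝ} {g : α → I}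
    (hf : Measurable f) (hg : Measurable g) :
    Measurable fun x => (foldedLaw (f x)).prod (Measure.dirac (g x)) := by
  have h := ((foldedKernel.comap f hf).prod (Kernel.deterministic g hg)).measurable
  convert h using 2 with x
  rw [Kernel.prod_apply, Kernel.comap_apply, Kernel.deterministic_apply]
  rfl

instance stepLaw_isProbabilityMeasure (a : ℝ) (p01 p11 : I) (s : State) (u : Bool) :
    IsProbabilityMeasure (stepLaw a p01 p11 s u) := by
  cases u
  · simp only [stepLaw, Bool.false_eq_true, if_false]
    infer_instance
  · refine ⟨?_⟩
    simp only [stepLaw, if_true, Measure.add_apply, Measure.smul_apply, measure_univ, smul_eq_mul,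
      mul_one]
    rw [← ENNReal.ofReal_add s.2.2.1 (sub_nonneg.2 s.2.2.2)]
    simp

theorem measurable_stepLaw (a : ℝ) (p01 p11 : I) :
    Measurable fun q : State × Bool => stepLaw a p01 p11 q.1 q.2 := by
  refine measurable_from_prod_countable_left fun u => ?_
  have hf : Measurable fun s : State => a * (s.1 : ℝ) := by fun_prop
  cases u
  · simp only [stepLaw, Bool.false_eq_true, if_false]
    exact measurable_foldedLaw_prod hf ((measurable_beliefStep p01 p11).comp measurable_snd)
  · simp only [stepLaw, if_true]
    refine Measure.measurable_of_measurable_coe _ fun B hB => ?_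
    simp only [Measure.add_apply, Measure.smul_apply, smul_eq_mul]
    have h := (Measure.measurable_coe hB).comp
      (measurable_foldedLaw_prod hf (measurable_const (a := p01)))
    have hb : Measurable fun s : State => (s.2 : ℝ) := by fun_prop
    exact (hb.ennreal_ofReal.mul_const _).add ((measurable_const.sub hb).ennreal_ofReal.mul h)

/-- The controlled transition kernel of the folded POMDP. -/
def transition (a : ℝ) (p01 p11 : I) : Kernel (State × Bool) State :=
  ⟨fun q => stepLaw a p01 p11 q.1 q.2, measurable_stepLaw a p01 p11⟩

instance (a : ℝ) (p01 p11 : I) : IsMarkovKernel (transition a p01 p11) :=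
  ⟨fun q => stepLaw_isProbabilityMeasure a p01 p11 q.1 q.2⟩

/-- The history of states up to and including time `t`. -/
abbrev History (t : ℕ) : Type := (Finset.Iic t) → State

/-- The state at time `t` in a history up to time `t`. -/
def History.current {t : ℕ} (h : History t) : State := h ⟨t, Finset.mem_Iic.2 le_rfl⟩

/-- A scheduling policy: at each time `t`, a measurable decision based on the history. -/
structure Policy where
  act : (t : ℕ) → History t → Bool
  measurable_act : ∀ t, Measurable (act t)

/-- The transition law at time `t`, given the history, of the process controlled by `φ`. -/
def Policy.kernel (a : ℝ) (p01 p11 : I) (φ : Policy) (t : ℕ) : Kernel (History t) State :=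
  (transition a p01 p11).comap (fun h : History t => (h.current, φ.act t h))
    ((measurable_pi_apply _).prodMk (φ.measurable_act t))

instance (a : ℝ) (p01 p11 : I) (φ : Policy) (t : ℕ) :
    IsMarkovKernel (φ.kernel a p01 p11 t) :=
  Kernel.IsMarkovKernel.comap _ _

/-- The law of the state trajectory started at `s` and controlled by `φ`. -/
def trajectoryLaw (a : ℝ) (p01 p11 : I) (φ : Policy) (s : State) : Measure (ℕ → State) :=
  Kernel.traj (X := fun _ => State) (φ.kernel a p01 p11) 0 (fun _ => s)

/-- The expected total discounted cost of the policy `φ` from the initial state `s`. -/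
def policyCost (a lam β : ℝ) (p01 p11 : I) (φ : Policy) (s : State) : ℝ≥0∞ :=
  ∫⁻ ω, ∑' t : ℕ, ENNReal.ofReal
      (β ^ t * stageCost lam (ω t) (φ.act t (fun i : Finset.Iic t => ω i)))
    ∂(trajectoryLaw a p01 p11 φ s)

/-- The optimal discounted value function. -/
def value (a lam β : ℝ) (p01 p11 : I) (s : State) : ℝ≥0∞ :=
  ⨅ φ : Policy, policyCost a lam β p01 p11 φ s

/-- The cost of taking action `u` in state `s` and proceeding optimally from the next state on. -/
def qValue (a lam β : ℝ) (p01 p11 : I) (s : State) (u : Bool) : ℝ≥0∞ :=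
  ENNReal.ofReal (stageCost lam s u) +
    ENNReal.ofReal β * ∫⁻ s', value a lam β p01 p11 s' ∂(stepLaw a p01 p11 s u)

/-- Action `u` is optimal in state `s`: it minimizes `qValue` and attains the optimal value. -/
def IsOptimalAction (a lam β : ℝ) (p01 p11 : I) (s : State) (u : Bool) : Prop :=
  (∀ u', qValue a lam β p01 p11 s u ≤ qValue a lam β p01 p11 s u') ∧
    qValue a lam β p01 p11 s u = value a lam β p01 p11 s

end RemoteEst

end

noncomputable section

/-! ### The folded Gaussian law and its stochastic monotonicity. -/

namespace RemoteEst

/-! Costs are nonnegative, so value iteration from `0` increases to a limit. By monotone convergence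
this limit solves the Bellman equation. It bounds the cost of every policy from below, and the
stationary policy minimizing the one-step lookahead attains it (`value_eq_limitValue`). It therefore
suffices to find properties that one Bellman step preserves and that survive limits.

In the error, monotonicity is preserved because the law of `|m + w|` increases stochastically with
`|m|` (`lintegral_foldedLaw_mono`).

In the belief, (C) is not inductive by itself; it is carried together with antitonicity and
concavity (`BeliefShape`). Silence composes the next cost with an affine map and discounts it, while
transmission is affine in the belief. Concavity bounds the cost of transmitting by that of silence
plus the price `L`. Conversely, at belief `0` the difference is exactly `L`; so, by near-convexity,
if silence is at least as good at `x`, it is so at every smaller belief. These two comparisons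
preserve (C) under the minimum (`BeliefShape.min_silentCost_transmitCost`).

The single crossing is strict when `r < 1`, `0 < L` and costs are finite, which gives the threshold.
Finiteness comes from a quadratic supersolution of the Bellman equation, based on always
transmitting. -/

theorem measurable_nnabs : Measurable fun x : ℝ => Real.nnabs x := by
  have h : (fun x : ℝ => Real.nnabs x) = fun x => ‖x‖₊ := by
    ext x
    simp
  exact h ▸ measurable_nnnorm

theorem lintegral_foldedLaw (m : ℝ) {f : ℝ≥0 → ℝ≥0∞} (hf : Measurable f) :
    ∫⁻ x, f x ∂foldedLaw m = ∫⁻ x : ℝ, gaussianPDF m 1 x * f (Real.nnabs x) := by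
  have hg : Measurable (gaussianPDF m 1) := measurable_gaussianPDF m 1
  have hn : Measurable fun x : ℝ => gaussianPDF m 1 (-x) := hg.comp measurable_neg
  have hF : Measurable fun x : ℝ => gaussianPDF m 1 x * f (Real.nnabs x) :=
    hg.mul (hf.comp measurable_nnabs)
  rw [foldedLaw, lintegral_map hf measurable_real_toNNReal,
    lintegral_withDensity_eq_lintegral_mul _ (f := fun x => gaussianPDF m 1 x + gaussianPDF m 1 (-x))
      (g := fun x => f x.toNNReal) (hg.add hn) (hf.comp measurable_real_toNNReal)]
  have h : ∫⁻ x in Set.Ici (0 : ℝ), gaussianPDF m 1 (-x) * f (Real.nnabs x)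
      = ∫⁻ x in Set.Iic (0 : ℝ), gaussianPDF m 1 x * f (Real.nnabs x) := by
    have := (Measure.measurePreserving_neg (volume : Measure ℝ)).setLIntegral_comp_preimage
      (s := Set.Iic (0 : ℝ)) measurableSet_Iic hF
    have hneg : ∀ x : ℝ, Real.nnabs (-x) = Real.nnabs x := fun x => by
      rw [← NNReal.coe_inj, Real.coe_nnabs, Real.coe_nnabs, abs_neg]
    simpa only [hneg, Set.neg_preimage, Set.neg_Iic, neg_zero] using this
  rw [← lintegral_add_compl _ measurableSet_Ici (μ := volume) (A := Set.Ici (0 : ℝ)), Set.compl_Ici,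
    setLIntegral_congr (Iio_ae_eq_Iic (a := (0 : ℝ)) (μ := volume)), ← h,
    ← lintegral_add_left hF]
  refine setLIntegral_congr_fun measurableSet_Ici fun x (hx : 0 ≤ x) => ?_
  simp only [Pi.mul_apply, add_mul, Real.nnabs_of_nonneg hx]

theorem lintegral_foldedLaw_eq_gaussianReal (m : ℝ) {f : ℝ≥0 → ℝ≥0∞} (hf : Measurable f) :
    ∫⁻ x, f x ∂foldedLaw m = ∫⁻ x, f (Real.nnabs x) ∂gaussianReal m 1 := by
  rw [lintegral_foldedLaw m hf, gaussianReal_of_var_ne_zero m one_ne_zero,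
    lintegral_withDensity_eq_lintegral_mul _ (measurable_gaussianPDF m 1)
      (g := fun x => f (Real.nnabs x)) (hf.comp measurable_nnabs)]
  rfl

theorem lintegral_sq_foldedLaw (m : ℝ) :
    ∫⁻ x, ENNReal.ofReal ((x : ℝ) ^ 2) ∂foldedLaw m = ENNReal.ofReal (m ^ 2 + 1) := by
  rw [lintegral_foldedLaw_eq_gaussianReal m (by fun_prop)]
  have h2 : MemLp id 2 (gaussianReal m 1) := memLp_id_gaussianReal 2
  have hv := variance_eq_sub h2
  rw [variance_id_gaussianReal] at hv
  simp only [Pi.pow_apply, id_eq, integral_id_gaussianReal, NNReal.coe_one] at hv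
  simp only [Real.coe_nnabs, sq_abs]
  rw [← ofReal_integral_eq_lintegral_ofReal (f := fun x : ℝ => x ^ 2) h2.integrable_sq (ae_of_all _ fun x => sq_nonneg _)]
  congr 1
  linarith

theorem foldedLaw_neg (m : ℝ) : foldedLaw (-m) = foldedLaw m := by
  have h : ∀ x, gaussianPDF (-m) 1 x = gaussianPDF m 1 (-x) := fun x => by
    simp only [gaussianPDF, gaussianPDFReal]
    congr 4
    ring
  rw [foldedLaw, foldedLaw]
  simp only [h, neg_neg, add_comm]

theorem foldedLaw_abs (m : ℝ) : foldedLaw |m| = foldedLaw m := by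
  rcases abs_choice m with h | h <;> rw [h]
  exact foldedLaw_neg m

theorem gaussianPDF_reflect (m m' x : ℝ) :
    gaussianPDF m' 1 (m + m' - x) = gaussianPDF m 1 x := by
  simp only [gaussianPDF, gaussianPDFReal]
  congr 4
  ring

theorem gaussianPDF_le_gaussianPDF {m m' x : ℝ} (h : (x - m) ^ 2 ≤ (x - m') ^ 2) :
    gaussianPDF m' 1 x ≤ gaussianPDF m 1 x := by
  simp only [gaussianPDF, gaussianPDFReal]
  gcongr

/-- The rearrangement inequality. Writing `p = q + r` avoids subtraction in `ℝ≥0∞`. -/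
theorem add_mul_rearrange {p q u v : ℝ≥0∞} (hqp : q ≤ p) (huv : u ≤ v) :
    p * u + q * v ≤ q * u + p * v := by
  obtain ⟨r, rfl⟩ := exists_add_of_le hqp
  have : r * u ≤ r * v := mul_le_mul_right huv r
  calc (q + r) * u + q * v = q * u + q * v + r * u := by ring
    _ ≤ q * u + q * v + r * v := by gcongr
    _ = q * u + (q + r) * v := by ring

/-- An integral over the line, folded at the point `c / 2`. -/
theorem lintegral_fold_midpoint (c : ℝ) {g : ℝ → ℝ≥0∞} (hg : Measurable g) :
    ∫⁻ x, g x = ∫⁻ x in Set.Iio (c / 2), (g x + g (c - x)) := by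
  rw [← lintegral_add_compl _ measurableSet_Iio (μ := volume) (A := Set.Iio (c / 2)), Set.compl_Iio,
    lintegral_add_left hg]
  congr 1
  have hp : MeasurePreserving (fun x : ℝ => c - x) volume volume := volume.measurePreserving_sub_left c
  have := hp.setLIntegral_comp_preimage (s := Set.Ioi (c / 2)) measurableSet_Ioi hg
  rw [setLIntegral_congr (Ioi_ae_eq_Ici (a := c / 2) (μ := volume)).symm, ← this]
  congr 2
  ext x
  simp only [Set.mem_preimage, Set.mem_Ioi, Set.mem_Iio]
  constructor <;> intro h <;> linarith

/-- The folded laws are stochastically increasing in the absolute value of the mean. -/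
theorem lintegral_foldedLaw_mono {m m' : ℝ} (h : |m| ≤ |m'|) {f : ℝ≥0 → ℝ≥0∞} (hf : Monotone f) :
    ∫⁻ x, f x ∂foldedLaw m ≤ ∫⁻ x, f x ∂foldedLaw m' := by
  have hfm : Measurable f := hf.measurable
  rw [← foldedLaw_abs m, ← foldedLaw_abs m', lintegral_foldedLaw _ hfm, lintegral_foldedLaw _ hfm]
  have h0 : 0 ≤ |m| := abs_nonneg m
  generalize |m| = k at h h0
  generalize |m'| = k' at h
  have hm : ∀ k, Measurable fun x : ℝ => gaussianPDF k 1 x * f (Real.nnabs x) := fun k =>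
    (measurable_gaussianPDF k 1).mul (hfm.comp measurable_nnabs)
  rw [lintegral_fold_midpoint (k + k') (hm k), lintegral_fold_midpoint (k + k') (hm k')]
  refine setLIntegral_mono' measurableSet_Iio fun x (hx : x < (k + k') / 2) => ?_
  rw [gaussianPDF_reflect]
  have hs : gaussianPDF k 1 (k + k' - x) = gaussianPDF k' 1 x := by
    rw [add_comm k k', gaussianPDF_reflect]
  rw [hs]
  -- Pair `x` with its mirror image `k + k' - x`: reflection swaps the two densities. Left of the
  -- midpoint, `x` is nearer to `k`, and since `k + k' ≥ 0` its absolute value is at most that of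
  -- its image. Moving from `k` to `k'` thus shifts mass to the larger value of `f`.
  refine add_mul_rearrange (gaussianPDF_le_gaussianPDF (by nlinarith)) (hf ?_)
  rw [← NNReal.coe_le_coe, Real.coe_nnabs, Real.coe_nnabs]
  refine sq_le_sq.1 ?_
  nlinarith

end RemoteEst

/-! ### Value iteration, the Bellman equation and optimal stationary policies. -/

namespace RemoteEst

variable {a lam β : ℝ} {p01 p11 : I}

/-- The expected cost of action `u` in state `s` with terminal cost `V` after one step. -/
def lookahead (a lam β : ℝ) (p01 p11 : I) (V : State → ℝ≥0∞) (s : State) (u : Bool) : ℝ≥0∞ :=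
  ENNReal.ofReal (stageCost lam s u) +
    ENNReal.ofReal β * ∫⁻ s', V s' ∂(stepLaw a p01 p11 s u)

/-- The dynamic programming operator. -/
def bellman (a lam β : ℝ) (p01 p11 : I) (V : State → ℝ≥0∞) (s : State) : ℝ≥0∞ :=
  min (lookahead a lam β p01 p11 V s false) (lookahead a lam β p01 p11 V s true)

/-- The optimal cost over a finite horizon. -/
def horizonValue (a lam β : ℝ) (p01 p11 : I) : ℕ → State → ℝ≥0∞
  | 0 => 0
  | n + 1 => bellman a lam β p01 p11 (horizonValue a lam β p01 p11 n)

/-- The limit of the finite horizon values. -/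
def limitValue (a lam β : ℝ) (p01 p11 : I) (s : State) : ℝ≥0∞ :=
  ⨆ n, horizonValue a lam β p01 p11 n s

theorem bellman_le_lookahead (V : State → ℝ≥0∞) (s : State) (u : Bool) :
    bellman a lam β p01 p11 V s ≤ lookahead a lam β p01 p11 V s u := by
  cases u
  · exact min_le_left _ _
  · exact min_le_right _ _

theorem measurable_stageCost (lam : ℝ) :
    Measurable fun q : State × Bool => stageCost lam q.1 q.2 := by
  refine measurable_from_prod_countable_left fun u => ?_
  exact (show Measurable fun s : State => (s.1 : ℝ) ^ 2 by fun_prop).add_const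
    (lam * if u then 1 else 0)

theorem measurable_lookahead {V : State → ℝ≥0∞} (hV : Measurable V) :
    Measurable fun q : State × Bool => lookahead a lam β p01 p11 V q.1 q.2 :=
  (measurable_stageCost lam).ennreal_ofReal.add
    ((hV.lintegral_kernel (κ := transition a p01 p11)).const_mul _)

theorem measurable_lookahead_action {V : State → ℝ≥0∞} (hV : Measurable V) (u : Bool) :
    Measurable fun s => lookahead a lam β p01 p11 V s u :=
  (measurable_lookahead hV).comp (g := fun q : State × Bool => lookahead a lam β p01 p11 V q.1 q.2)
    (f := fun s => (s, u)) (measurable_id.prodMk measurable_const)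

theorem measurable_bellman {V : State → ℝ≥0∞} (hV : Measurable V) :
    Measurable (bellman a lam β p01 p11 V) :=
  (measurable_lookahead_action hV false).min (measurable_lookahead_action hV true)

theorem measurable_horizonValue (n : ℕ) : Measurable (horizonValue a lam β p01 p11 n) := by
  induction n with
  | zero => exact measurable_const
  | succ n ih => exact measurable_bellman ih

theorem measurable_limitValue : Measurable (limitValue a lam β p01 p11) :=
  Measurable.iSup measurable_horizonValue

theorem lookahead_mono {V W : State → ℝ≥0∞} (h : V ≤ W) (s : State) (u : Bool) :
    lookahead a lam β p01 p11 V s u ≤ lookahead a lam β p01 p11 W s u := by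
  unfold lookahead
  gcongr
  exact h _

theorem bellman_mono {V W : State → ℝ≥0∞} (h : V ≤ W) :
    bellman a lam β p01 p11 V ≤ bellman a lam β p01 p11 W := fun s =>
  min_le_min (lookahead_mono h s _) (lookahead_mono h s _)

theorem horizonValue_mono : Monotone (horizonValue a lam β p01 p11) := by
  refine monotone_nat_of_le_succ fun n => ?_
  induction n with
  | zero => exact fun _ => zero_le
  | succ n ih => exact bellman_mono ih

/-- Comparison principle: iteration starts at `0`, so any supersolution stays above it. The
finiteness bound rests on this. -/
theorem horizonValue_le_of_bellman_le {W : State → ℝ≥0∞} (h : bellman a lam β p01 p11 W ≤ W)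
    (n : ℕ) : horizonValue a lam β p01 p11 n ≤ W := by
  induction n with
  | zero => exact fun _ => zero_le
  | succ n ih => exact (bellman_mono ih).trans h

theorem tendsto_horizonValue (s : State) :
    Filter.Tendsto (fun n => horizonValue a lam β p01 p11 n s) Filter.atTop
      (nhds (limitValue a lam β p01 p11 s)) :=
  tendsto_atTop_iSup fun _ _ h => horizonValue_mono h s

theorem tendsto_lookahead (s : State) (u : Bool) :
    Filter.Tendsto (fun n => lookahead a lam β p01 p11 (horizonValue a lam β p01 p11 n) s u)
      Filter.atTop (nhds (lookahead a lam β p01 p11 (limitValue a lam β p01 p11) s u)) := by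
  refine tendsto_const_nhds.add (ENNReal.Tendsto.const_mul ?_ (Or.inr ENNReal.ofReal_ne_top))
  exact lintegral_tendsto_of_tendsto_of_monotone
    (fun n => (measurable_horizonValue n).aemeasurable)
    (ae_of_all _ fun s _ _ h => horizonValue_mono h s) (ae_of_all _ tendsto_horizonValue)

/-- Monotone convergence passes the limit through the integrals and `min` is continuous; the
iterates and their shift by one have the same limit. -/
theorem bellman_limitValue :
    bellman a lam β p01 p11 (limitValue a lam β p01 p11) = limitValue a lam β p01 p11 := by
  funext s
  exact tendsto_nhds_unique ((tendsto_lookahead s false).min (tendsto_lookahead s true))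
    ((tendsto_horizonValue s).comp (Filter.tendsto_add_atTop_nat 1))

instance (φ : Policy) (s : State) : IsProbabilityMeasure (trajectoryLaw a p01 p11 φ s) := by
  unfold trajectoryLaw
  infer_instance

/-- The expected stage cost at time `t`. -/
def expectedStageCost (a lam : ℝ) (p01 p11 : I) (φ : Policy) (s : State) (t : ℕ) : ℝ≥0∞ :=
  ∫⁻ ω, ENNReal.ofReal (stageCost lam (ω t) (φ.act t (fun i : Finset.Iic t => ω i)))
    ∂(trajectoryLaw a p01 p11 φ s)

theorem measurable_stateAction (φ : Policy) (t : ℕ) :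
    Measurable fun ω : ℕ → State => (ω t, φ.act t (fun i : Finset.Iic t => ω i)) :=
  (measurable_pi_apply t).prodMk ((φ.measurable_act t).comp (by fun_prop))

theorem policyCost_eq_tsum (hβ : 0 ≤ β) (φ : Policy) (s : State) :
    policyCost a lam β p01 p11 φ s =
      ∑' t, ENNReal.ofReal β ^ t * expectedStageCost a lam p01 p11 φ s t := by
  have hm : ∀ t, Measurable fun ω : ℕ → State =>
      ENNReal.ofReal (stageCost lam (ω t) (φ.act t (fun i : Finset.Iic t => ω i))) := fun t =>
    ((measurable_stageCost lam).comp (measurable_stateAction φ t)).ennreal_ofReal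
  unfold policyCost expectedStageCost
  simp_rw [ENNReal.ofReal_mul (pow_nonneg hβ _), ENNReal.ofReal_pow hβ]
  rw [lintegral_tsum fun t => ((hm t).const_mul _).aemeasurable]
  exact tsum_congr fun t => lintegral_const_mul _ (hm t)

theorem lintegral_trajectoryLaw_zero (φ : Policy) (s : State) {V : State → ℝ≥0∞}
    (hV : Measurable V) : ∫⁻ ω, V (ω 0) ∂(trajectoryLaw a p01 p11 φ s) = V s := by
  have hc : Measurable fun h : History 0 => V h.current := hV.comp (measurable_pi_apply _)
  have h := lintegral_map (μ := trajectoryLaw a p01 p11 φ s) (g := Preorder.frestrictLe 0)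
    hc (by fun_prop)
  rw [trajectoryLaw, Kernel.traj_map_frestrictLe_apply, Kernel.partialTraj_self, Kernel.id_apply,
    lintegral_dirac' _ hc] at h
  exact h.symm

theorem lintegral_trajectoryLaw_succ (φ : Policy) (s : State) (t : ℕ) {V : State → ℝ≥0∞}
    (hV : Measurable V) :
    ∫⁻ ω, V (ω (t + 1)) ∂(trajectoryLaw a p01 p11 φ s) =
      ∫⁻ ω, ∫⁻ s', V s' ∂(stepLaw a p01 p11 (ω t) (φ.act t (fun i : Finset.Iic t => ω i)))
        ∂(trajectoryLaw a p01 p11 φ s) := by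
  have hc : Measurable fun q : History t × State => V q.2 := hV.comp measurable_snd
  have h := lintegral_map (μ := trajectoryLaw a p01 p11 φ s)
    (g := fun ω => (Preorder.frestrictLe t ω, ω (t + 1))) hc (by fun_prop)
  -- Disintegration at time `t`: the joint law of the history and the next state is the history law
  -- composed with the controlled kernel.
  rw [trajectoryLaw, ← Kernel.partialTraj_compProd_eq_map_traj (Nat.zero_le t),
    Measure.lintegral_compProd hc, ← Kernel.traj_map_frestrictLe_apply,
    lintegral_map (hV.lintegral_kernel (κ := φ.kernel a p01 p11 t)) (by fun_prop)] at h
  exact h.symm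

theorem lintegral_lookahead (φ : Policy) (s : State) (t : ℕ) {V : State → ℝ≥0∞}
    (hV : Measurable V) :
    ∫⁻ ω, lookahead a lam β p01 p11 V (ω t) (φ.act t (fun i : Finset.Iic t => ω i))
        ∂(trajectoryLaw a p01 p11 φ s) =
      expectedStageCost a lam p01 p11 φ s t +
        ENNReal.ofReal β * ∫⁻ ω, V (ω (t + 1)) ∂(trajectoryLaw a p01 p11 φ s) := by
  have h1 : Measurable fun ω : ℕ → State =>
      ENNReal.ofReal (stageCost lam (ω t) (φ.act t (fun i : Finset.Iic t => ω i))) :=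
    ((measurable_stageCost lam).comp (measurable_stateAction φ t)).ennreal_ofReal
  have h2 : Measurable fun ω : ℕ → State =>
      ∫⁻ s', V s' ∂(stepLaw a p01 p11 (ω t) (φ.act t (fun i : Finset.Iic t => ω i))) :=
    (hV.lintegral_kernel (κ := transition a p01 p11)).comp (measurable_stateAction φ t)
  unfold lookahead
  rw [lintegral_add_left h1, lintegral_const_mul _ h2, lintegral_trajectoryLaw_succ φ s t hV]
  rfl

theorem sum_range_succ_discounted (c : ℕ → ℝ≥0∞) (b : ℝ≥0∞) (n t : ℕ) :
    ∑ i ∈ Finset.range (n + 1), b ^ i * c (t + i) =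
      c t + b * ∑ i ∈ Finset.range n, b ^ i * c (t + 1 + i) := by
  rw [Finset.sum_range_succ', Finset.mul_sum, add_comm]
  congr 1
  · simp
  · refine Finset.sum_congr rfl fun i _ => ?_
    rw [pow_succ', mul_assoc, add_assoc t 1 i, add_comm 1 i]

/-- A history-dependent policy does not restart as a policy after one step, so the induction stays
on one trajectory and compares its tails; hence `t` is arbitrary. -/
theorem lintegral_horizonValue_le (φ : Policy) (s : State) (n t : ℕ) :
    ∫⁻ ω, horizonValue a lam β p01 p11 n (ω t) ∂(trajectoryLaw a p01 p11 φ s) ≤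
      ∑ i ∈ Finset.range n,
        ENNReal.ofReal β ^ i * expectedStageCost a lam p01 p11 φ s (t + i) := by
  induction n generalizing t with
  | zero => simp [horizonValue]
  | succ n ih =>
    rw [sum_range_succ_discounted]
    refine (lintegral_mono fun ω => bellman_le_lookahead _ _ _).trans
      ((lintegral_lookahead φ s t (measurable_horizonValue n)).le.trans ?_)
    gcongr
    exact ih (t + 1)

theorem limitValue_le_policyCost (hβ : 0 ≤ β) (φ : Policy) (s : State) :
    limitValue a lam β p01 p11 s ≤ policyCost a lam β p01 p11 φ s := by
  refine iSup_le fun n => ?_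
  rw [policyCost_eq_tsum hβ, ← lintegral_trajectoryLaw_zero φ s (measurable_horizonValue n)]
  refine (lintegral_horizonValue_le φ s n 0).trans ?_
  simp only [zero_add]
  exact ENNReal.sum_le_tsum _

/-- Unrolling the equality gives a partial cost plus a nonnegative terminal term. Only an upper
bound is wanted, so that term is dropped and no transversality condition is needed. -/
theorem policyCost_le_of_lookahead_eq (hβ : 0 ≤ β) (φ : Policy) {V : State → ℝ≥0∞}
    (hV : Measurable V)
    (h : ∀ t (x : History t), lookahead a lam β p01 p11 V x.current (φ.act t x) = V x.current)
    (s : State) : policyCost a lam β p01 p11 φ s ≤ V s := by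
  have key : ∀ n t, ∑ i ∈ Finset.range n,
      ENNReal.ofReal β ^ i * expectedStageCost a lam p01 p11 φ s (t + i) ≤
        ∫⁻ ω, V (ω t) ∂(trajectoryLaw a p01 p11 φ s) := by
    intro n
    induction n with
    | zero => simp
    | succ n ih =>
      intro t
      rw [sum_range_succ_discounted]
      calc _ ≤ expectedStageCost a lam p01 p11 φ s t +
            ENNReal.ofReal β * ∫⁻ ω, V (ω (t + 1)) ∂(trajectoryLaw a p01 p11 φ s) := by
            gcongr
            exact ih (t + 1)
        _ = ∫⁻ ω, V (ω t) ∂(trajectoryLaw a p01 p11 φ s) := by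
            rw [← lintegral_lookahead φ s t hV]
            exact lintegral_congr fun ω => h t (fun i : Finset.Iic t => ω i)
  rw [policyCost_eq_tsum hβ, ENNReal.tsum_eq_iSup_nat]
  refine iSup_le fun n => ?_
  rw [← lintegral_trajectoryLaw_zero φ s hV]
  simpa using key n 0

/-- The stationary policy that transmits on a given measurable set of states. -/
def Policy.stationary (T : Set State) (hT : MeasurableSet T) : Policy where
  act t h := by classical exact decide (h.current ∈ T)
  measurable_act t := by
    classical
    refine measurable_to_bool ?_
    have : MeasurableSet {h : History t | h.current ∈ T} := (measurable_pi_apply _) hT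
    convert this using 1
    ext h
    simp

theorem Policy.stationary_act {T : Set State} {hT : MeasurableSet T} {t : ℕ} (h : History t) :
    (Policy.stationary T hT).act t h = true ↔ h.current ∈ T := by
  simp [Policy.stationary]

/-- The states in which transmitting minimizes the expected cost. -/
def transmitSet (a lam β : ℝ) (p01 p11 : I) : Set State :=
  {s | lookahead a lam β p01 p11 (limitValue a lam β p01 p11) s true ≤
    lookahead a lam β p01 p11 (limitValue a lam β p01 p11) s false}

theorem measurableSet_transmitSet : MeasurableSet (transmitSet a lam β p01 p11) :=
  measurableSet_le (measurable_lookahead_action measurable_limitValue true)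
    (measurable_lookahead_action measurable_limitValue false)

theorem policyCost_stationary_le (hβ : 0 ≤ β) (s : State) :
    policyCost a lam β p01 p11
      (Policy.stationary (transmitSet a lam β p01 p11) measurableSet_transmitSet) s ≤
      limitValue a lam β p01 p11 s := by
  refine policyCost_le_of_lookahead_eq hβ _ measurable_limitValue (fun t x => ?_) s
  have hact := Policy.stationary_act (hT := measurableSet_transmitSet (a := a) (lam := lam)
    (β := β) (p01 := p01) (p11 := p11)) x
  conv_rhs => rw [← bellman_limitValue]
  by_cases hx : x.current ∈ transmitSet a lam β p01 p11
  · rw [hact.2 hx]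
    exact (min_eq_right hx).symm
  · rw [Bool.eq_false_iff.2 fun h => hx (hact.1 h)]
    exact (min_eq_left (not_le.1 hx).le).symm

theorem value_eq_limitValue (hβ : 0 ≤ β) :
    value a lam β p01 p11 = limitValue a lam β p01 p11 := by
  funext s
  exact le_antisymm ((iInf_le _ _).trans (policyCost_stationary_le hβ s))
    (le_iInf fun φ => limitValue_le_policyCost hβ φ s)

end RemoteEst

/-! ### Functions of the belief: antitone, concave and nearly convex. -/

namespace RemoteEst

theorem ofReal_add_ofReal_one_sub (b : I) :
    ENNReal.ofReal (b : ℝ) + ENNReal.ofReal (1 - (b : ℝ)) = 1 := by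
  rw [← ENNReal.ofReal_add b.2.1 (sub_nonneg.2 b.2.2)]
  simp

theorem ofReal_mixture {x y z b : I} (h : (z : ℝ) = (b : ℝ) * x + (1 - (b : ℝ)) * y) :
    ENNReal.ofReal (z : ℝ) = ENNReal.ofReal (b : ℝ) * ENNReal.ofReal (x : ℝ) +
      ENNReal.ofReal (1 - (b : ℝ)) * ENNReal.ofReal (y : ℝ) := by
  have hb := sub_nonneg.2 b.2.2
  rw [← ENNReal.ofReal_mul b.2.1, ← ENNReal.ofReal_mul hb, h,
    ENNReal.ofReal_add (mul_nonneg b.2.1 x.2.1) (mul_nonneg hb y.2.1)]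

theorem ofReal_one_sub_mixture {x y z b : I} (h : (z : ℝ) = (b : ℝ) * x + (1 - (b : ℝ)) * y) :
    ENNReal.ofReal (1 - (z : ℝ)) = ENNReal.ofReal (b : ℝ) * ENNReal.ofReal (1 - (x : ℝ)) +
      ENNReal.ofReal (1 - (b : ℝ)) * ENNReal.ofReal (1 - (y : ℝ)) := by
  have hb := sub_nonneg.2 b.2.2
  rw [← ENNReal.ofReal_mul b.2.1, ← ENNReal.ofReal_mul hb, h,
    ← ENNReal.ofReal_add (mul_nonneg b.2.1 (sub_nonneg.2 x.2.2))
      (mul_nonneg hb (sub_nonneg.2 y.2.2))]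
  congr 1
  ring

theorem beliefStep_mixture {p01 p11 x y z b : I}
    (h : (z : ℝ) = (b : ℝ) * x + (1 - (b : ℝ)) * y) :
    (beliefStep p01 p11 z : ℝ) =
      (b : ℝ) * beliefStep p01 p11 x + (1 - (b : ℝ)) * beliefStep p01 p11 y := by
  simp only [beliefStep, h]
  ring

theorem beliefStep_mono {p01 p11 : I} (hp : p01 ≤ p11) : Monotone (beliefStep p01 p11) := by
  intro x y h
  have hp' : (p01 : ℝ) ≤ p11 := hp
  have h' : (x : ℝ) ≤ y := h
  change (x : ℝ) * p11 + (1 - (x : ℝ)) * p01 ≤ (y : ℝ) * p11 + (1 - (y : ℝ)) * p01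
  nlinarith

theorem beliefStep_zero (p01 p11 : I) : beliefStep p01 p11 0 = p01 := by
  ext
  simp [beliefStep]

/-- Smaller beliefs are compared through the endpoint `0`, where the gap between transmission and
silence is known exactly. -/
theorem exists_mixture_zero {x y : I} (h : y ≤ x) :
    ∃ b : I, (y : ℝ) = (b : ℝ) * x + (1 - (b : ℝ)) * (0 : I) := by
  have h' : (y : ℝ) ≤ x := h
  rcases x.2.1.eq_or_lt with hx | hx
  · refine ⟨0, ?_⟩
    have := y.2.1
    simp only [Set.Icc.coe_zero]
    linarith
  · refine ⟨⟨y / x, div_nonneg y.2.1 x.2.1, (div_le_one hx).2 h'⟩, ?_⟩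
    simp only [Set.Icc.coe_zero, mul_zero, add_zero]
    exact (div_mul_cancel₀ _ hx.ne').symm

/-- A cost that is antitone and concave in the belief, and convex up to the price `L` of a
failed transmission. -/
structure BeliefShape (L : ℝ≥0∞) (f : I → ℝ≥0∞) : Prop where
  antitone : Antitone f
  concave : ∀ x y z b : I, (z : ℝ) = (b : ℝ) * x + (1 - (b : ℝ)) * y →
    ENNReal.ofReal (b : ℝ) * f x + ENNReal.ofReal (1 - (b : ℝ)) * f y ≤ f z
  nearConvex : ∀ x y z b : I, y ≤ x → (z : ℝ) = (b : ℝ) * x + (1 - (b : ℝ)) * y →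
    f z ≤ ENNReal.ofReal (1 - (b : ℝ)) * L + ENNReal.ofReal (b : ℝ) * f x +
      ENNReal.ofReal (1 - (b : ℝ)) * f y

theorem beliefShape_zero (L : ℝ≥0∞) : BeliefShape L fun _ => 0 :=
  ⟨antitone_const, fun _ _ _ _ _ => by simp, fun _ _ _ _ _ _ => zero_le⟩

theorem BeliefShape.lintegral {α : Type*} [MeasurableSpace α] {μ : Measure α}
    [IsProbabilityMeasure μ] {L : ℝ≥0∞} {f : α → I → ℝ≥0∞} (hm : ∀ b, Measurable fun x => f x b)
    (hf : ∀ x, BeliefShape L (f x)) : BeliefShape L fun b => ∫⁻ x, f x b ∂μ where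
  antitone _ _ h := lintegral_mono fun x => (hf x).antitone h
  concave x y z b h := by
    rw [← lintegral_const_mul _ (hm x), ← lintegral_const_mul _ (hm y),
      ← lintegral_add_left ((hm x).const_mul _)]
    exact lintegral_mono fun s => (hf s).concave x y z b h
  nearConvex x y z b hyx h := by
    have hL : ENNReal.ofReal (1 - (b : ℝ)) * L = ∫⁻ _, ENNReal.ofReal (1 - (b : ℝ)) * L ∂μ := by
      simp
    rw [hL, ← lintegral_const_mul _ (hm x), ← lintegral_const_mul _ (hm y),
      ← lintegral_add_left measurable_const,
      ← lintegral_add_right _ ((hm y).const_mul _)]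
    exact lintegral_mono fun s => (hf s).nearConvex x y z b hyx h

theorem BeliefShape.of_tendsto {L : ℝ≥0∞} {f : ℕ → I → ℝ≥0∞} {g : I → ℝ≥0∞}
    (hf : ∀ n, BeliefShape L (f n))
    (h : ∀ b, Filter.Tendsto (fun n => f n b) Filter.atTop (nhds (g b))) : BeliefShape L g := by
  have hc : ∀ (t : ℝ) (b : I), Filter.Tendsto (fun n => ENNReal.ofReal t * f n b) Filter.atTop
      (nhds (ENNReal.ofReal t * g b)) := fun t b =>
    ENNReal.Tendsto.const_mul (h b) (Or.inr ENNReal.ofReal_ne_top)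
  exact
    { antitone := fun x y hxy => le_of_tendsto_of_tendsto' (h y) (h x) fun n =>
        (hf n).antitone hxy
      concave := fun x y z b hz => le_of_tendsto_of_tendsto' ((hc _ x).add (hc _ y)) (h z) fun n =>
        (hf n).concave x y z b hz
      nearConvex := fun x y z b hyx hz => le_of_tendsto_of_tendsto' (h z)
        ((tendsto_const_nhds.add (hc _ x)).add (hc _ y)) fun n =>
          (hf n).nearConvex x y z b hyx hz }

/-! ### One Bellman step at a fixed error, and the threshold. -/

/-- The cost of not transmitting, as a function of the belief. -/
def silentCost (p01 p11 : I) (E r : ℝ≥0∞) (C : I → ℝ≥0∞) (b : I) : ℝ≥0∞ :=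
  E + r * C (beliefStep p01 p11 b)

/-- The cost of transmitting, as a function of the belief. -/
def transmitCost (E L r A B : ℝ≥0∞) (b : I) : ℝ≥0∞ :=
  E + L + r * (ENNReal.ofReal (b : ℝ) * A + ENNReal.ofReal (1 - (b : ℝ)) * B)

variable {p01 p11 : I} {E L r A B : ℝ≥0∞} {C : I → ℝ≥0∞}

theorem transmitCost_mixture {x y z b : I} (h : (z : ℝ) = (b : ℝ) * x + (1 - (b : ℝ)) * y) :
    transmitCost E L r A B z = ENNReal.ofReal (b : ℝ) * transmitCost E L r A B x +
      ENNReal.ofReal (1 - (b : ℝ)) * transmitCost E L r A B y := by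
  unfold transmitCost
  rw [ofReal_mixture h, ofReal_one_sub_mixture h]
  have h1 := ofReal_add_ofReal_one_sub b
  generalize ENNReal.ofReal (b : ℝ) = p at h1 ⊢
  generalize ENNReal.ofReal (1 - (b : ℝ)) = q at h1 ⊢
  nth_rewrite 1 [← one_mul (E + L), ← h1]
  ring

theorem transmitCost_antitone (h : A ≤ B) : Antitone (transmitCost E L r A B) := by
  intro x y hxy
  have hxy' : (0 : ℝ) ≤ y - x := sub_nonneg.2 hxy
  unfold transmitCost
  gcongr E + L + r * ?_
  have h1 : ENNReal.ofReal (y : ℝ) = ENNReal.ofReal (x : ℝ) + ENNReal.ofReal ((y : ℝ) - x) := by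
    rw [← ENNReal.ofReal_add x.2.1 hxy']
    congr 1
    ring
  have h2 : ENNReal.ofReal (1 - (x : ℝ)) =
      ENNReal.ofReal (1 - (y : ℝ)) + ENNReal.ofReal ((y : ℝ) - x) := by
    rw [← ENNReal.ofReal_add (sub_nonneg.2 y.2.2) hxy']
    congr 1
    ring
  rw [h1, h2]
  calc _ = ENNReal.ofReal (x : ℝ) * A + ENNReal.ofReal (1 - (y : ℝ)) * B +
        ENNReal.ofReal ((y : ℝ) - x) * A := by ring
    _ ≤ ENNReal.ofReal (x : ℝ) * A + ENNReal.ofReal (1 - (y : ℝ)) * B +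
        ENNReal.ofReal ((y : ℝ) - x) * B := by gcongr
    _ = _ := by ring

theorem continuous_transmitCost (hr : r ≠ ⊤) (hA : A ≠ ⊤) (hB : B ≠ ⊤) :
    Continuous (transmitCost E L r A B) := by
  unfold transmitCost
  have h1 : Continuous fun b : I => ENNReal.ofReal (b : ℝ) :=
    ENNReal.continuous_ofReal.comp (by fun_prop)
  have h2 : Continuous fun b : I => ENNReal.ofReal (1 - (b : ℝ)) :=
    ENNReal.continuous_ofReal.comp (by fun_prop)
  exact continuous_const.add ((ENNReal.continuous_const_mul hr).comp
    (((ENNReal.continuous_mul_const hA).comp h1).add ((ENNReal.continuous_mul_const hB).comp h2)))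

/-- At belief `0` transmission surely fails, and the belief `p01` that follows is also the one that
follows silence; only the price differs. -/
theorem transmitCost_zero :
    transmitCost E L r A (C p01) 0 = silentCost p01 p11 E r C 0 + L := by
  simp only [transmitCost, silentCost, beliefStep_zero, Set.Icc.coe_zero, ENNReal.ofReal_zero,
    zero_mul, sub_zero, ENNReal.ofReal_one, one_mul, zero_add]
  ring

/-- The belief after silence is the mixture of `p11` and `p01` with weight `b`, so concavity makes
learning the outcome of a transmission no worse than not learning it. -/
theorem transmitCost_le (hC : BeliefShape L C) (hA : A ≤ C p11) (b : I) :
    transmitCost E L r A (C p01) b ≤ L + silentCost p01 p11 E r C b := by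
  unfold transmitCost silentCost
  calc _ ≤ E + L + r * (ENNReal.ofReal (b : ℝ) * C p11 + ENNReal.ofReal (1 - (b : ℝ)) * C p01) := by
        gcongr
    _ ≤ E + L + r * C (beliefStep p01 p11 b) := by
        gcongr
        exact hC.concave p11 p01 _ b rfl
    _ = _ := by ring

/-- The belief update is affine and monotone, so the shape is inherited. The defect shrinks from `L`
to `r * L`, and this slack later gives strictness. -/
theorem BeliefShape.silentCost (hp : p01 ≤ p11) (hC : BeliefShape L C) :
    BeliefShape (r * L) (silentCost p01 p11 E r C) where
  antitone x y h := by
    unfold RemoteEst.silentCost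
    gcongr
    exact hC.antitone (beliefStep_mono hp h)
  concave x y z b h := by
    have h1 := ofReal_add_ofReal_one_sub b
    unfold RemoteEst.silentCost
    calc _ = (ENNReal.ofReal (b : ℝ) + ENNReal.ofReal (1 - (b : ℝ))) * E +
          r * (ENNReal.ofReal (b : ℝ) * C (beliefStep p01 p11 x) +
            ENNReal.ofReal (1 - (b : ℝ)) * C (beliefStep p01 p11 y)) := by ring
      _ ≤ E + r * C (beliefStep p01 p11 z) := by
          rw [h1, one_mul]
          gcongr
          exact hC.concave _ _ _ b (beliefStep_mixture h)
  nearConvex x y z b hyx h := by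
    have h1 := ofReal_add_ofReal_one_sub b
    unfold RemoteEst.silentCost
    calc _ ≤ (ENNReal.ofReal (b : ℝ) + ENNReal.ofReal (1 - (b : ℝ))) * E +
          r * (ENNReal.ofReal (1 - (b : ℝ)) * L +
            ENNReal.ofReal (b : ℝ) * C (beliefStep p01 p11 x) +
            ENNReal.ofReal (1 - (b : ℝ)) * C (beliefStep p01 p11 y)) := by
          rw [h1, one_mul]
          gcongr
          exact hC.nearConvex _ _ _ b (beliefStep_mono hp hyx) (beliefStep_mixture h)
      _ = _ := by ring

/-- Write `y` as a mixture of `x` and `0`. Silence is convex up to `(1 - b) * (r * L)`, whereas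
affine transmission pays the full `(1 - b) * L` through its value at `0`. -/
theorem silentCost_le_transmitCost_of_le (hp : p01 ≤ p11) (hr : r ≤ 1) (hC : BeliefShape L C)
    {x y : I} (hyx : y ≤ x)
    (hx : silentCost p01 p11 E r C x ≤ transmitCost E L r A (C p01) x) :
    silentCost p01 p11 E r C y ≤ transmitCost E L r A (C p01) y := by
  obtain ⟨b, hb⟩ := exists_mixture_zero hyx
  refine ((hC.silentCost hp).nearConvex x 0 y b unitInterval.nonneg' hb).trans ?_
  rw [transmitCost_mixture hb, transmitCost_zero (p11 := p11)]
  calc _ ≤ ENNReal.ofReal (1 - (b : ℝ)) * (1 * L) +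
        ENNReal.ofReal (b : ℝ) * transmitCost E L r A (C p01) x +
        ENNReal.ofReal (1 - (b : ℝ)) * silentCost p01 p11 E r C 0 := by gcongr
    _ = _ := by ring

theorem silentCost_lt_transmitCost_of_lt (hp : p01 ≤ p11) (hr : r < 1) (hL0 : L ≠ 0) (hL : L ≠ ⊤)
    (hC : BeliefShape L C) (htop : ∀ b, silentCost p01 p11 E r C b ≠ ⊤)
    {x y : I} (hyx : y < x)
    (hx : silentCost p01 p11 E r C x ≤ transmitCost E L r A (C p01) x) :
    silentCost p01 p11 E r C y < transmitCost E L r A (C p01) y := by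
  obtain ⟨b, hb⟩ := exists_mixture_zero hyx.le
  have hb1 : (b : ℝ) < 1 := by
    refine lt_of_le_of_ne b.2.2 fun h1 => hyx.ne (Subtype.ext ?_)
    rw [hb, h1]
    simp
  have hq : ENNReal.ofReal (1 - (b : ℝ)) ≠ 0 := by
    simpa using hb1
  refine ((hC.silentCost hp).nearConvex x 0 y b unitInterval.nonneg' hb).trans_lt ?_
  rw [transmitCost_mixture hb, transmitCost_zero (p11 := p11)]
  have hlt : ENNReal.ofReal (1 - (b : ℝ)) * (r * L) < ENNReal.ofReal (1 - (b : ℝ)) * L := by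
    refine ENNReal.mul_lt_mul_right hq ENNReal.ofReal_ne_top ?_
    simpa using ENNReal.mul_lt_mul_left hL0 hL hr
  calc _ = ENNReal.ofReal (1 - (b : ℝ)) * (r * L) +
        (ENNReal.ofReal (b : ℝ) * silentCost p01 p11 E r C x +
        ENNReal.ofReal (1 - (b : ℝ)) * silentCost p01 p11 E r C 0) := by ring
    _ < ENNReal.ofReal (1 - (b : ℝ)) * L +
        (ENNReal.ofReal (b : ℝ) * silentCost p01 p11 E r C x +
        ENNReal.ofReal (1 - (b : ℝ)) * silentCost p01 p11 E r C 0) := by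
        refine ENNReal.add_lt_add_right ?_ hlt
        exact ENNReal.add_ne_top.2 ⟨ENNReal.mul_ne_top ENNReal.ofReal_ne_top (htop x),
          ENNReal.mul_ne_top ENNReal.ofReal_ne_top (htop 0)⟩
    _ ≤ ENNReal.ofReal (1 - (b : ℝ)) * L +
        (ENNReal.ofReal (b : ℝ) * transmitCost E L r A (C p01) x +
        ENNReal.ofReal (1 - (b : ℝ)) * silentCost p01 p11 E r C 0) := by gcongr
    _ = _ := by ring

/-- A minimum of a concave and an affine function is concave. For near-convexity, split on the
better action at `x`: if silence, single crossing makes it best at `y` too and its own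
near-convexity applies; if transmission, use it at `z`, losing at most `L` with weight `1 - b` at
`y`. -/
theorem BeliefShape.min_silentCost_transmitCost (hp : p01 ≤ p11) (hr : r ≤ 1)
    (hC : BeliefShape L C) (hA : A ≤ C p11) :
    BeliefShape L fun b =>
      min (RemoteEst.silentCost p01 p11 E r C b) (transmitCost E L r A (C p01) b) where
  antitone x y h := min_le_min ((hC.silentCost hp).antitone h)
    (transmitCost_antitone (hA.trans (hC.antitone hp)) h)
  concave x y z b h := by
    refine le_min (le_trans ?_ ((hC.silentCost hp).concave x y z b h))
      (le_trans ?_ (transmitCost_mixture h).ge)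
    · gcongr <;> exact min_le_left _ _
    · gcongr <;> exact min_le_right _ _
  nearConvex x y z b hyx h := by
    rcases le_total (RemoteEst.silentCost p01 p11 E r C x) (transmitCost E L r A (C p01) x)
      with hx | hx
    · rw [min_eq_left hx, min_eq_left (silentCost_le_transmitCost_of_le hp hr hC hyx hx)]
      refine (min_le_left _ _).trans (((hC.silentCost hp).nearConvex x y z b hyx h).trans ?_)
      gcongr
      exact mul_le_of_le_one_left' hr
    · rw [min_eq_right hx]
      refine (min_le_right _ _).trans ((transmitCost_mixture h).le.trans ?_)
      have hy : transmitCost E L r A (C p01) y ≤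
          L + min (RemoteEst.silentCost p01 p11 E r C y) (transmitCost E L r A (C p01) y) := by
        rw [← min_add_add_left]
        exact le_min (transmitCost_le hC hA y) le_add_self
      calc _ ≤ ENNReal.ofReal (b : ℝ) * transmitCost E L r A (C p01) x +
            ENNReal.ofReal (1 - (b : ℝ)) * (L + min (RemoteEst.silentCost p01 p11 E r C y)
              (transmitCost E L r A (C p01) y)) := by gcongr
        _ = _ := by ring

theorem exists_threshold (hp : p01 ≤ p11) (hr : r < 1) (hL : L ≠ ⊤)
    (hC : BeliefShape L C) (hA : A ≤ C p11) (hE : E ≠ ⊤) (htop : ∀ b, C b ≠ ⊤) :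
    ∃ c : ℝ, ∀ b : I, transmitCost E L r A (C p01) b ≤ silentCost p01 p11 E r C b ↔ c ≤ b := by
  have hr' : r ≠ ⊤ := hr.ne_top
  set S : Set I := {b | transmitCost E L r A (C p01) b ≤ silentCost p01 p11 E r C b} with hS
  have hup : ∀ y ∈ S, ∀ x, y ≤ x → x ∈ S := by
    intro y hy x hyx
    -- With a free transmission there is no strict gap, but then transmitting is never worse than
    -- silence.
    rcases eq_or_ne L 0 with rfl | hL0
    · exact (transmitCost_le hC hA x).trans (zero_add _).le
    rcases hyx.eq_or_lt with rfl | hlt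
    · exact hy
    by_contra hx
    refine absurd hy (not_le.2 (silentCost_lt_transmitCost_of_lt hp hr hL0 hL hC (fun b => ?_) hlt
      (not_le.1 hx).le))
    exact ENNReal.add_ne_top.2 ⟨hE, ENNReal.mul_ne_top hr' (htop _)⟩
  rcases S.eq_empty_or_nonempty with h0 | hne
  -- Any number above `1` encodes that transmission is never chosen.
  · refine ⟨2, fun b => ⟨fun h => ?_, fun h => ?_⟩⟩
    · exact absurd (show b ∈ S from h) (h0 ▸ Set.notMem_empty b)
    · linarith [b.2.2]
  obtain ⟨c, hcS, hc⟩ := (isClosed_closure (s := S)).isCompact.exists_isLeast hne.closure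
  have hcont := continuous_transmitCost (E := E) (L := L) hr'
    (ne_top_of_le_ne_top (htop _) hA) (htop p01)
  -- The least point of the closure lies in `S` without continuity of `C`: on `S`, transmission
  -- costs at most `silentCost` at `c` by antitonicity, and this bound passes to the closure because
  -- the transmission cost is continuous.
  have hmem : c ∈ S := by
    refine closure_minimal (t := {b | transmitCost E L r A (C p01) b ≤ silentCost p01 p11 E r C c})
      (fun b hb => ?_) (isClosed_le hcont continuous_const) hcS
    exact le_trans (show _ ≤ _ from hb) ((hC.silentCost hp).antitone (hc (subset_closure hb)))
  exact ⟨c, fun b => ⟨fun h => hc (subset_closure h), fun h => hup c hmem b h⟩⟩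

end RemoteEst

/-! ### Shape of the value function in error and belief. -/

namespace RemoteEst

variable {a lam β : ℝ} {p01 p11 : I} {V : State → ℝ≥0∞}

theorem lintegral_foldedLaw_prod_dirac (hV : Measurable V) (m : ℝ) (b : I) :
    ∫⁻ s, V s ∂((foldedLaw m).prod (Measure.dirac b)) = ∫⁻ e, V (e, b) ∂foldedLaw m := by
  rw [lintegral_prod _ hV.aemeasurable]
  refine lintegral_congr fun e => ?_
  rw [lintegral_dirac' (f := fun b => V (e, b)) _ (hV.comp measurable_prodMk_left)]

theorem lookahead_false (hV : Measurable V) (e : ℝ≥0) (b : I) :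
    lookahead a lam β p01 p11 V (e, b) false =
      silentCost p01 p11 (ENNReal.ofReal ((e : ℝ) ^ 2)) (ENNReal.ofReal β)
        (fun b' => ∫⁻ e', V (e', b') ∂foldedLaw (a * e)) b := by
  simp only [lookahead, stepLaw, stageCost, silentCost, Bool.false_eq_true, if_false, mul_zero,
    add_zero]
  rw [lintegral_foldedLaw_prod_dirac hV]

theorem lookahead_true (hlam : 0 ≤ lam) (hV : Measurable V) (e : ℝ≥0) (b : I) :
    lookahead a lam β p01 p11 V (e, b) true =
      transmitCost (ENNReal.ofReal ((e : ℝ) ^ 2)) (ENNReal.ofReal lam) (ENNReal.ofReal β)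
        (∫⁻ e', V (e', p11) ∂foldedLaw 0) (∫⁻ e', V (e', p01) ∂foldedLaw (a * e)) b := by
  simp only [lookahead, stepLaw, stageCost, transmitCost, if_true, mul_one]
  rw [lintegral_add_measure, lintegral_smul_measure, lintegral_smul_measure,
    lintegral_foldedLaw_prod_dirac hV, lintegral_foldedLaw_prod_dirac hV,
    ENNReal.ofReal_add (sq_nonneg _) hlam]
  rfl

/-- Functions of the state that are monotone in the error and well shaped in the belief. -/
structure StateShape (lam : ℝ) (V : State → ℝ≥0∞) : Prop where
  measurable : Measurable V
  monotone : ∀ b, Monotone fun e : ℝ≥0 => V (e, b)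
  belief : ∀ e, BeliefShape (ENNReal.ofReal lam) fun b => V (e, b)

theorem StateShape.lintegral (hV : StateShape lam V) (m : ℝ) :
    BeliefShape (ENNReal.ofReal lam) fun b => ∫⁻ e, V (e, b) ∂foldedLaw m :=
  BeliefShape.lintegral (fun _ => hV.measurable.comp measurable_prodMk_right) hV.belief

/-- Success resets the mean to `0`, the stochastically smallest case; this is the condition `A ≤ C
p11` of the belief lemmas. -/
theorem StateShape.lintegral_zero_le (hV : StateShape lam V) (m : ℝ) (b : I) :
    ∫⁻ e, V (e, b) ∂foldedLaw 0 ≤ ∫⁻ e, V (e, b) ∂foldedLaw m :=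
  lintegral_foldedLaw_mono (by simp) (hV.monotone b)

theorem StateShape.bellman (hlam : 0 ≤ lam) (hβ : β ≤ 1) (hp : p01 ≤ p11)
    (hV : StateShape lam V) : StateShape lam (bellman a lam β p01 p11 V) where
  measurable := measurable_bellman hV.measurable
  monotone b e e' h := by
    have hae : |a * (e : ℝ)| ≤ |a * (e' : ℝ)| := by
      rw [abs_mul, abs_mul, NNReal.abs_eq, NNReal.abs_eq]
      gcongr
    have he : ENNReal.ofReal ((e : ℝ) ^ 2) ≤ ENNReal.ofReal ((e' : ℝ) ^ 2) := by gcongr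
    have hmono : ∀ b', ∫⁻ x, V (x, b') ∂foldedLaw (a * e) ≤ ∫⁻ x, V (x, b') ∂foldedLaw (a * e') :=
      fun b' => lintegral_foldedLaw_mono hae (hV.monotone b')
    refine min_le_min ?_ ?_
    · rw [lookahead_false hV.measurable, lookahead_false hV.measurable]
      unfold silentCost
      gcongr
      exact hmono _
    · rw [lookahead_true hlam hV.measurable, lookahead_true hlam hV.measurable]
      unfold transmitCost
      -- After a success the next state does not depend on the current error, so only the stage cost
      -- and the failure term vary.
      gcongr ?_ + _ + _ * (_ + _ * ?_)
      exact hmono p01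
  belief e := by
    have h := (hV.lintegral (a * e)).min_silentCost_transmitCost
      (E := ENNReal.ofReal ((e : ℝ) ^ 2)) (r := ENNReal.ofReal β) hp
      (ENNReal.ofReal_le_one.2 hβ) (hV.lintegral_zero_le (a * e) p11)
    simpa only [RemoteEst.bellman, lookahead_false hV.measurable,
      lookahead_true hlam hV.measurable] using h

theorem stateShape_limitValue (hlam : 0 ≤ lam) (hβ : β ≤ 1) (hp : p01 ≤ p11) :
    StateShape lam (limitValue a lam β p01 p11) := by
  have h : ∀ n, StateShape lam (horizonValue a lam β p01 p11 n) := by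
    intro n
    induction n with
    | zero => exact ⟨measurable_const, fun _ => monotone_const, fun _ => beliefShape_zero _⟩
    | succ n ih => exact ih.bellman hlam hβ hp
  exact ⟨measurable_limitValue,
    fun b e e' hee => iSup_mono fun n => (h n).monotone b hee,
    fun e => BeliefShape.of_tendsto (fun n => (h n).belief e) fun b => tendsto_horizonValue (e, b)⟩

/-! ### Finiteness and conclusion. -/

theorem lintegral_quadratic_foldedLaw (m : ℝ) {K c : ℝ} (hK : 0 ≤ K) (hc : 0 ≤ c) :
    ∫⁻ e, ENNReal.ofReal (K + c * (e : ℝ) ^ 2) ∂foldedLaw m =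
      ENNReal.ofReal (K + c * (m ^ 2 + 1)) := by
  have h : ∀ e : ℝ≥0, ENNReal.ofReal (K + c * (e : ℝ) ^ 2) =
      ENNReal.ofReal K + ENNReal.ofReal c * ENNReal.ofReal ((e : ℝ) ^ 2) := fun e => by
    rw [ENNReal.ofReal_add hK (by positivity), ENNReal.ofReal_mul hc]
  simp_rw [h]
  rw [lintegral_add_left measurable_const, lintegral_const_mul _ (by fun_prop),
    lintegral_sq_foldedLaw, ENNReal.ofReal_add hK (by positivity), ENNReal.ofReal_mul hc]
  simp

/-- Transmitting always has a finite cost: a quadratic function of the error dominates it. -/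
theorem exists_limitValue_le (hlam : 0 ≤ lam) (hβ0 : 0 ≤ β) (hβ1 : β < 1)
    (hstab : a ^ 2 * (1 - (p01 : ℝ)) < 1) :
    ∃ K c : ℝ, 0 ≤ K ∧ 0 ≤ c ∧
      ∀ s : State, limitValue a lam β p01 p11 s ≤ ENNReal.ofReal (K + c * (s.1 : ℝ) ^ 2) := by
  have hd : 0 < 1 - a ^ 2 * (1 - (p01 : ℝ)) := by linarith
  have hβ : 0 < 1 - β := by linarith
  -- `M` is the extra coefficient of `e²` caused by a failure: growth by `a²`, with belief reset to
  -- `p01`. Stability makes this linear equation solvable with `M ≥ 0`.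
  obtain ⟨M, hM0, hM⟩ : ∃ M : ℝ, 0 ≤ M ∧ a ^ 2 * (1 + M * (1 - (p01 : ℝ))) = M := by
    refine ⟨a ^ 2 / (1 - a ^ 2 * (1 - (p01 : ℝ))), by positivity, ?_⟩
    field_simp
    ring
  -- `K` absorbs the price and the unit noise variance, whose coefficient in `W` is at most `1 + M`.
  obtain ⟨K, hK0, hK⟩ : ∃ K : ℝ, 0 ≤ K ∧ lam + β * (K + (1 + M)) ≤ K := by
    refine ⟨(lam + 1 + M) / (1 - β), by positivity, ?_⟩
    have h : (lam + 1 + M) / (1 - β) * (1 - β) = lam + 1 + M := div_mul_cancel₀ _ hβ.ne'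
    nlinarith
  set W : State → ℝ≥0∞ := fun s =>
    ENNReal.ofReal (K + (1 + M * (1 - (s.2 : ℝ))) * (s.1 : ℝ) ^ 2) with hW
  have hWm : Measurable W := by
    refine Measurable.ennreal_ofReal ?_
    fun_prop
  have hcoef : ∀ b : I, 0 ≤ 1 + M * (1 - (b : ℝ)) := fun b =>
    add_nonneg zero_le_one (mul_nonneg hM0 (sub_nonneg.2 b.2.2))
  have hle : bellman a lam β p01 p11 W ≤ W := by
    rintro ⟨e, b⟩
    refine (bellman_le_lookahead W _ true).trans ?_
    rw [lookahead_true hlam hWm]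
    simp only [hW, transmitCost, lintegral_quadratic_foldedLaw _ hK0 (hcoef _)]
    have h11 := hcoef p11
    have h01 := hcoef p01
    have hb0 := b.2.1
    have hb1 := sub_nonneg.2 b.2.2
    rw [← ENNReal.ofReal_mul hb0, ← ENNReal.ofReal_mul hb1,
      ← ENNReal.ofReal_add (by positivity) hlam,
      ← ENNReal.ofReal_add (by positivity) (by positivity), ← ENNReal.ofReal_mul hβ0,
      ← ENNReal.ofReal_add (by positivity) (by positivity)]
    refine ENNReal.ofReal_le_ofReal ?_
    have hle : ∀ p : I, 1 + M * (1 - (p : ℝ)) ≤ 1 + M := fun p => by nlinarith [p.2.1]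
    have hnoise : (b : ℝ) * (1 + M * (1 - (p11 : ℝ))) + (1 - (b : ℝ)) * (1 + M * (1 - (p01 : ℝ)))
        ≤ 1 + M := by
      nlinarith [hle p11, hle p01]
    have hsq : β * ((1 - (b : ℝ)) * M * (e : ℝ) ^ 2) ≤ (1 - (b : ℝ)) * M * (e : ℝ) ^ 2 :=
      mul_le_of_le_one_left (by positivity) hβ1.le
    have hexp : β * ((b : ℝ) * (K + (1 + M * (1 - (p11 : ℝ))) * (0 ^ 2 + 1)) +
        (1 - (b : ℝ)) * (K + (1 + M * (1 - (p01 : ℝ))) * ((a * e) ^ 2 + 1))) =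
        β * (K + ((b : ℝ) * (1 + M * (1 - (p11 : ℝ))) +
          (1 - (b : ℝ)) * (1 + M * (1 - (p01 : ℝ))))) +
        β * ((1 - (b : ℝ)) * (a ^ 2 * (1 + M * (1 - (p01 : ℝ)))) * (e : ℝ) ^ 2) := by ring
    rw [hexp, hM]
    have := mul_le_mul_of_nonneg_left hnoise hβ0
    nlinarith
  refine ⟨K, 1 + M, hK0, by positivity, fun s =>
    (iSup_le fun n => horizonValue_le_of_bellman_le hle n s).trans (ENNReal.ofReal_le_ofReal ?_)⟩
  gcongr
  nlinarith [s.2.2.1]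

theorem limitValue_lt_top (hlam : 0 ≤ lam) (hβ0 : 0 ≤ β) (hβ1 : β < 1)
    (hstab : a ^ 2 * (1 - (p01 : ℝ)) < 1) (s : State) : limitValue a lam β p01 p11 s < ⊤ := by
  obtain ⟨K, c, -, -, h⟩ := exists_limitValue_le (p11 := p11) hlam hβ0 hβ1 hstab
  exact (h s).trans_lt ENNReal.ofReal_lt_top

/-- The strict single crossing cancels expected continuation costs, so their integrals must be
finite; pointwise finiteness would not suffice. -/
theorem lintegral_limitValue_ne_top (hlam : 0 ≤ lam) (hβ0 : 0 ≤ β) (hβ1 : β < 1)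
    (hstab : a ^ 2 * (1 - (p01 : ℝ)) < 1) (m : ℝ) (b : I) :
    ∫⁻ e, limitValue a lam β p01 p11 (e, b) ∂foldedLaw m ≠ ⊤ := by
  obtain ⟨K, c, hK, hc, h⟩ := exists_limitValue_le (p11 := p11) hlam hβ0 hβ1 hstab
  refine ((lintegral_mono fun e => h (e, b)).trans_lt ?_).ne
  rw [lintegral_quadratic_foldedLaw m hK hc]
  exact ENNReal.ofReal_lt_top

theorem exists_belief_threshold (hlam : 0 ≤ lam) (hβ0 : 0 ≤ β) (hβ1 : β < 1)
    (hstab : a ^ 2 * (1 - (p01 : ℝ)) < 1) (hp : p01 ≤ p11) (e : ℝ≥0) :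
    ∃ c : ℝ, ∀ b : I, (e, b) ∈ transmitSet a lam β p01 p11 ↔ c ≤ b := by
  have hV := stateShape_limitValue (a := a) hlam hβ1.le hp
  have h := exists_threshold (E := ENNReal.ofReal ((e : ℝ) ^ 2)) (r := ENNReal.ofReal β) hp
    (ENNReal.ofReal_lt_one.2 hβ1) ENNReal.ofReal_ne_top (hV.lintegral (a * e))
    (hV.lintegral_zero_le (a * e) p11) ENNReal.ofReal_ne_top
    (lintegral_limitValue_ne_top hlam hβ0 hβ1 hstab _)
  simpa only [transmitSet, Set.mem_ofPred_eq, lookahead_false hV.measurable,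
    lookahead_true hlam hV.measurable] using h

/-- By the Bellman equation a minimizing action automatically attains the value, so only the
comparison with silence remains. -/
theorem isOptimalAction_true_iff (hβ : 0 ≤ β) (s : State) :
    IsOptimalAction a lam β p01 p11 s true ↔ s ∈ transmitSet a lam β p01 p11 := by
  have hq : ∀ u, qValue a lam β p01 p11 s u =
      lookahead a lam β p01 p11 (limitValue a lam β p01 p11) s u := fun u => by
    rw [← value_eq_limitValue hβ]
    rfl
  unfold IsOptimalAction
  simp only [hq, value_eq_limitValue hβ]
  refine ⟨fun h => h.1 false, fun h => ⟨fun u => ?_, ?_⟩⟩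
  · cases u
    · exact h
    · exact le_rfl
  · conv_rhs => rw [← bellman_limitValue]
    exact (min_eq_right h).symm

end RemoteEst

end

theorem theorem1 (a lam β : ℝ) (p01 p11 : unitInterval)
    (hlam : 0 ≤ lam) (hβ0 : 0 < β) (hβ1 : β < 1)
    (hp01 : 0 < (p01 : ℝ)) (hp11 : 0 < (p11 : ℝ))
    (hstab : a ^ 2 * (1 - (p01 : ℝ)) < 1)
    (hchan : (p01 : ℝ) ≤ (p11 : ℝ)) :
    -- the optimal value is finite
    (∀ s, RemoteEst.value a lam β p01 p11 s < ⊤) ∧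
    -- (A)
    (∀ b : unitInterval, Monotone fun e : NNReal => RemoteEst.value a lam β p01 p11 (e, b)) ∧
    -- (B)
    (∀ e : NNReal, Antitone fun b : unitInterval => RemoteEst.value a lam β p01 p11 (e, b)) ∧
    -- (C)
    (∀ (e : NNReal) (x y z b : unitInterval), y ≤ x →
      (z : ℝ) = (b : ℝ) * x + (1 - (b : ℝ)) * y →
      RemoteEst.value a lam β p01 p11 (e, z) ≤
        ENNReal.ofReal ((1 - (b : ℝ)) * lam)
          + ENNReal.ofReal (b : ℝ) * RemoteEst.value a lam β p01 p11 (e, x)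
          + ENNReal.ofReal (1 - (b : ℝ)) * RemoteEst.value a lam β p01 p11 (e, y)) ∧
    -- (D)
    (∃ bstar : NNReal → ℝ,
      (∀ (e : NNReal) (b : unitInterval),
        RemoteEst.IsOptimalAction a lam β p01 p11 (e, b) true ↔ bstar e ≤ (b : ℝ)) ∧
      ∃ φ : RemoteEst.Policy,
        (∀ (t : ℕ) (h : RemoteEst.History t),
          φ.act t h = true ↔ bstar h.current.1 ≤ (h.current.2 : ℝ)) ∧
        ∀ s, RemoteEst.policyCost a lam β p01 p11 φ s = RemoteEst.value a lam β p01 p11 s) := by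
  have hβ := hβ0.le
  have hp : p01 ≤ p11 := hchan
  have hV := RemoteEst.stateShape_limitValue (a := a) hlam hβ1.le hp
  have hact := RemoteEst.isOptimalAction_true_iff (a := a) (lam := lam) (p01 := p01)
    (p11 := p11) hβ
  rw [RemoteEst.value_eq_limitValue hβ]
  refine ⟨RemoteEst.limitValue_lt_top hlam hβ hβ1 hstab, hV.monotone,
    fun e => (hV.belief e).antitone, fun e x y z b hyx hz => ?_, ?_⟩
  · rw [ENNReal.ofReal_mul (sub_nonneg.2 b.2.2)]
    exact (hV.belief e).nearConvex x y z b hyx hz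
  · choose bstar hb using RemoteEst.exists_belief_threshold (a := a) hlam hβ hβ1 hstab hp
    refine ⟨bstar, fun e b => (hact (e, b)).trans (hb e b), RemoteEst.Policy.stationary _
      RemoteEst.measurableSet_transmitSet, fun t h => ?_, fun s => le_antisymm
        (RemoteEst.policyCost_stationary_le hβ s) (RemoteEst.limitValue_le_policyCost hβ _ s)⟩
    exact (RemoteEst.Policy.stationary_act h).trans (hb h.current.1 h.current.2)
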